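/- All algebras are non-empty. An unbounded distributive pre-bilattice is an algebra $\mathbf A=(A;\lor_t,\land_t,\lor_k,\land_k)$ such that $(A;\lor_t,\land_t)$ and $(A;\lor_k,\land_k)$ are lattices and each of the four operations distributes over each of the other three. Let $\mathcal{DPB}_u$ be the variety of these algebras, and $\mathcal D_u$ the variety of distributive lattices without bounds in the language, both regarded as categories with all homomorphisms as morphisms. Let $\mathbf 2_u^{+}$ and $\mathbf 2_u^{-}$ be the algebras on $\{0,1\}$ (elements written $0^{\pm},1^{\pm}$) whose $t$-lattice is the chain $0<1$ and whose $k$-lattice is the chain $0<1$ for $\mathbf 2_u^{+}$ and its order dual for $\mathbf 2_u^{-}$. Let $\mathcal X$ be the category of isomorphic copies of closed substructures of non-empty powers (formed by sorts) of the two-sorted topological structure $$\underset{\sim}{\mathcal M}=(\{0^+,1^+\}\,\dot\cup\,\{0^-,1^-\};\ r^+,r^-,0^+,1^+,0^-,1^-,\mathcal T),$$ where $r^{+}$ is $\leq_k$ on $\mathbf 2_u^{+}$, $r^-$ is $\leq_k$ on $\mathbf 2_u^{-}$, the four constants are nullary operations and $\mathcal T$ is discrete; morphisms are the continuous maps that preserve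 sorts, relations and nullary operations. Let $D(\mathbf A)=\mathcal{DPB}_u(\mathbf A,\mathbf 2_u^+)\,\dot\cup\,\mathcal{DPB}_u(\mathbf A,\mathbf 2_u^-)$, as a substructure of $\underset{\sim}{\mathcal M}^{A}$, and let $E(\mathbf X)=\mathcal X(\mathbf X,\underset{\sim}{\mathcal M})$, as a subalgebra of $(\mathbf 2_u^+)^{X_+}\times(\mathbf 2_u^-)^{X_-}$; both functors act on morphisms by composition. **Theorem 10.3.** 1. $\mathcal{DPB}_u=\mathbb{ISP}(\mathbf 2_u^+,\mathbf 2_u^-)$. 2. $\underset{\sim}{\mathcal M}$ yields a strong duality on $\mathcal{DPB}_u$: for every $\mathbf A\in\mathcal{DPB}_u$ the evaluation map $e_{\mathbf A}\colon\mathbf A\to ED(\mathbf A)$, $e_{\mathbf A}(a)(x)=x(a)$, is an isomorphism; every closed substructure of a non-empty power $\underset{\sim}{\mathcal M}^S$ is term-closed, i.e. each point of $\underset{\sim}{\mathcal M}^S$ outside it is separated by two $S$-ary terms whose term functions agree on the substructure (in both sorts); and (the equivalent customary form of strongness) $\underset{\sim}{\mathcal M}$ is injective in $\mathcal X$ with respect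 to embeddings. 3. Hence the duality is full: moreover $\varepsilon_{\mathbf X}\colon\mathbf X\to DE(\mathbf X)$, $\varepsilon_{\mathbf X}(x)(f)=f(x)$, is an isomorphism for every $\mathbf X\in\mathcal X$. 4. Consequently $\mathcal{DPB}_u$ is categorically equivalent to $\mathcal D_u\times\mathcal D_u$. -/

import Mathlib

open CategoryTheory Opposite

universe u v w

namespace PreBilattice

/-! ### Algebras with four binary operations -/

/-- The operations `∨_t, ∧_t, ∨_k, ∧_k`, without any laws. -/
class BilatOps (A : Type u) where
  tsup : A → A → A
  tinf : A → A → A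
  ksup : A → A → A
  kinf : A → A → A

open BilatOps

/-- `j` and `m` are the join and the meet of a lattice. -/
structure IsLatticePair {A : Type u} (j m : A → A → A) : Prop where
  join_comm : ∀ a b, j a b = j b a
  meet_comm : ∀ a b, m a b = m b a
  join_assoc : ∀ a b c, j (j a b) c = j a (j b c)
  meet_assoc : ∀ a b c, m (m a b) c = m a (m b c)
  join_absorb : ∀ a b, j a (m a b) = a
  meet_absorb : ∀ a b, m a (j a b) = a

/-- `f` distributes over `g` (one-sided; the operations used are commutative). -/
def DistribOver {A : Type u} (f g : A → A → A) : Prop :=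
  ∀ a b c, f a (g b c) = g (f a b) (f a c)

/-- The laws of unbounded distributive pre-bilattices: two lattices, and each of the four operations
distributes over each of the other three. -/
structure IsUnboundedDPB (A : Type u) [BilatOps A] : Prop where
  t_lattice : IsLatticePair (tsup (A := A)) tinf
  k_lattice : IsLatticePair (ksup (A := A)) kinf
  tsup_tinf : DistribOver (tsup (A := A)) tinf
  tsup_ksup : DistribOver (tsup (A := A)) ksup
  tsup_kinf : DistribOver (tsup (A := A)) kinf
  tinf_tsup : DistribOver (tinf (A := A)) tsup
  tinf_ksup : DistribOver (tinf (A := A)) ksup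
  tinf_kinf : DistribOver (tinf (A := A)) kinf
  ksup_tsup : DistribOver (ksup (A := A)) tsup
  ksup_tinf : DistribOver (ksup (A := A)) tinf
  ksup_kinf : DistribOver (ksup (A := A)) kinf
  kinf_tsup : DistribOver (kinf (A := A)) tsup
  kinf_tinf : DistribOver (kinf (A := A)) tinf
  kinf_ksup : DistribOver (kinf (A := A)) ksup

/-- Homomorphisms: maps that preserve the four operations. -/
@[ext]
structure BHom (A : Type u) (B : Type v) [BilatOps A] [BilatOps B] where
  toFun : A → B
  map_tsup : ∀ a b, toFun (tsup a b) = tsup (toFun a) (toFun b)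
  map_tinf : ∀ a b, toFun (tinf a b) = tinf (toFun a) (toFun b)
  map_ksup : ∀ a b, toFun (ksup a b) = ksup (toFun a) (toFun b)
  map_kinf : ∀ a b, toFun (kinf a b) = kinf (toFun a) (toFun b)

/-- The identity homomorphism. -/
def BHom.id (A : Type u) [BilatOps A] : BHom A A :=
  ⟨fun a => a, fun _ _ => rfl, fun _ _ => rfl, fun _ _ => rfl, fun _ _ => rfl⟩

/-- Composition of homomorphisms (`g` after `f`). -/
def BHom.comp {A : Type u} {B : Type v} {C : Type w} [BilatOps A] [BilatOps B] [BilatOps C]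
    (g : BHom B C) (f : BHom A B) : BHom A C where
  toFun a := g.toFun (f.toFun a)
  map_tsup a b := by rw [f.map_tsup, g.map_tsup]
  map_tinf a b := by rw [f.map_tinf, g.map_tinf]
  map_ksup a b := by rw [f.map_ksup, g.map_ksup]
  map_kinf a b := by rw [f.map_kinf, g.map_kinf]

/-- Products carry the coordinatewise operations. -/
instance piOps {I : Type u} (B : I → Type v) [∀ i, BilatOps (B i)] : BilatOps (∀ i, B i) where
  tsup f g i := tsup (f i) (g i)
  tinf f g i := tinf (f i) (g i)
  ksup f g i := ksup (f i) (g i)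
  kinf f g i := kinf (f i) (g i)

/-- Non-empty algebras with operations `∨_t, ∧_t, ∨_k, ∧_k`, without any laws. -/
structure BAlg : Type (u + 1) where
  carrier : Type u
  [ops : BilatOps carrier]
  [nonempty : Nonempty carrier]

attribute [instance] BAlg.ops BAlg.nonempty

instance : Category.{u} BAlg.{u} where
  Hom A B := BHom A.carrier B.carrier
  id A := BHom.id A.carrier
  comp f g := BHom.comp g f

/-- The class of (non-empty) unbounded distributive pre-bilattices. -/
def dpbClass : ObjectProperty BAlg.{u} := fun A => IsUnboundedDPB A.carrier

/-- The variety of unbounded distributive pre-bilattices, as a category with all homomorphisms. -/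
abbrev DPBu : Type (u + 1) := (dpbClass.{u}).FullSubcategory

/-- `ISP` of a family of algebras: isomorphic copies of subalgebras of products of members of the
family, that is, algebras with an injective homomorphism into such a product. -/
def ispClass {ι : Type} (M : ι → Type) [∀ i, BilatOps (M i)] : ObjectProperty BAlg.{u} := fun A =>
  ∃ (I : Type u) (σ : I → ι) (f : BHom A.carrier (∀ i, M (σ i))), Function.Injective f.toFun

/-- The category of (non-empty) distributive lattices, bounds not included in the type. -/
abbrev Du : Type (u + 1) := ObjectProperty.FullSubcategory (fun L : DistLat.{u} => Nonempty L)

/-! ### The two generating algebras -/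

/-- Names for the two sorts. -/
inductive Sgn : Type
  | pos
  | neg

/-- The universe `{0, 1}` of `2_u^+` and of `2_u^-`, with `0 = false` and `1 = true`. -/
def TwoU (_ : Sgn) : Type := Bool

/-- In both algebras the `t`-lattice is the chain `0 < 1`; the `k`-lattice is that chain in `2_u^+`
and its order dual in `2_u^-`. -/
instance twoUOps : (s : Sgn) → BilatOps (TwoU s)
  | .pos => { tsup := Bool.or, tinf := Bool.and, ksup := Bool.or, kinf := Bool.and }
  | .neg => { tsup := Bool.or, tinf := Bool.and, ksup := Bool.and, kinf := Bool.or }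

/-- The knowledge order `≤_k` of `2_u^±`. -/
def kLE (s : Sgn) (a b : TwoU s) : Prop := kinf a b = a

instance (s : Sgn) : DecidableEq (TwoU s) := inferInstanceAs (DecidableEq Bool)

instance (s : Sgn) : Fintype (TwoU s) := inferInstanceAs (Fintype Bool)

instance (s : Sgn) : TopologicalSpace (TwoU s) := ⊥

instance (s : Sgn) : DiscreteTopology (TwoU s) := ⟨rfl⟩

theorem isUnboundedDPB_twoU (s : Sgn) : IsUnboundedDPB (TwoU s) := by
  cases s <;> constructor <;> first
    | (constructor <;> decide)
    | (unfold DistribOver; decide)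

theorem continuous_op {s : Sgn} {T : Type u} [TopologicalSpace T] (op : TwoU s → TwoU s → TwoU s)
    {f g : T → TwoU s} (hf : Continuous f) (hg : Continuous g) :
    Continuous fun x => op (f x) (g x) :=
  (continuous_of_discreteTopology (f := fun p : TwoU s × TwoU s => op p.1 p.2)).comp
    (hf.prodMk hg)

/-! ### Two-sorted topological structures -/

/-- Two-sorted topological structures of the type of the alter ego: on each sort a topology, one
binary relation and two nullary operations. (The topology on the disjoint union of the sorts is the
disjoint union topology, which amounts to a topology on each sort.) -/
structure TSStruct : Type (u + 1) where
  carrier : Sgn → Type u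
  [top : ∀ s, TopologicalSpace (carrier s)]
  rel : ∀ s, carrier s → carrier s → Prop
  zero : ∀ s, carrier s
  one : ∀ s, carrier s

attribute [instance] TSStruct.top

/-- Morphisms: continuous sort-preserving maps that preserve relations and nullary operations. -/
@[ext]
structure TSHom (X : TSStruct.{u}) (Y : TSStruct.{v}) where
  toFun : ∀ s, X.carrier s → Y.carrier s
  cont : ∀ s, Continuous (toFun s)
  map_rel : ∀ s x y, X.rel s x y → Y.rel s (toFun s x) (toFun s y)
  map_zero : ∀ s, toFun s (X.zero s) = Y.zero s
  map_one : ∀ s, toFun s (X.one s) = Y.one s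

/-- The identity morphism. -/
def TSHom.id (X : TSStruct.{u}) : TSHom X X where
  toFun _ x := x
  cont _ := continuous_id
  map_rel _ _ _ h := h
  map_zero _ := rfl
  map_one _ := rfl

/-- Composition of morphisms (`g` after `f`). -/
def TSHom.comp {X : TSStruct.{u}} {Y : TSStruct.{v}} {Z : TSStruct.{w}}
    (g : TSHom Y Z) (f : TSHom X Y) : TSHom X Z where
  toFun s x := g.toFun s (f.toFun s x)
  cont s := (g.cont s).comp (f.cont s)
  map_rel s _ _ h := g.map_rel s _ _ (f.map_rel s _ _ h)
  map_zero s := by rw [f.map_zero, g.map_zero]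
  map_one s := by rw [f.map_one, g.map_one]

instance : Category.{u} TSStruct.{u} where
  Hom X Y := TSHom X Y
  id X := TSHom.id X
  comp f g := TSHom.comp g f

/-- The alter ego `({0⁺,1⁺} ∪ {0⁻,1⁻}; ≤_k on 2_u^+, ≤_k on 2_u^-, 0⁺, 1⁺, 0⁻, 1⁻, discrete)`. -/
def alterEgo : TSStruct.{0} where
  carrier := TwoU
  rel := kLE
  zero _ := false
  one _ := true

/-- The power of the alter ego with exponent `S`, formed by sorts, with the product topology and
pointwise structure. -/
def power (S : Type u) : TSStruct.{u} where
  carrier s := S → TwoU s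
  top _ := Pi.topologicalSpace
  rel s x y := ∀ i, kLE s (x i) (y i)
  zero s _ := alterEgo.zero s
  one s _ := alterEgo.one s

/-- The topologically closed substructures of `Y`. -/
structure ClosedSub (Y : TSStruct.{u}) where
  sets : ∀ s, Set (Y.carrier s)
  closed : ∀ s, IsClosed (sets s)
  zero_mem : ∀ s, Y.zero s ∈ sets s
  one_mem : ∀ s, Y.one s ∈ sets s

/-- A closed substructure as a structure, with the subspace topology and restricted relations. -/
def ClosedSub.toStruct {Y : TSStruct.{u}} (C : ClosedSub Y) : TSStruct.{u} where
  carrier s := C.sets s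
  top _ := instTopologicalSpaceSubtype
  rel s x y := Y.rel s x.1 y.1
  zero s := ⟨Y.zero s, C.zero_mem s⟩
  one s := ⟨Y.one s, C.one_mem s⟩

/-- `IS_cP` of the alter ego: isomorphic copies of closed substructures of non-empty powers. -/
def iscpClass : ObjectProperty TSStruct.{u} := fun X =>
  ∃ (S : Type u) (_ : Nonempty S) (C : ClosedSub (power S)), Nonempty (X ≅ C.toStruct)

/-- The dual category. -/
abbrev DualCat : Type (u + 1) := (iscpClass.{u}).FullSubcategory

/-! ### The hom-functors -/

/-- The two-sorted hom-set `A(A, 2_u^+) ∪ A(A, 2_u^-)`, with the topology and the structure that it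
has as a subset of the power with exponent `A`. -/
def homStruct (A : Type u) [BilatOps A] [Nonempty A] : TSStruct.{u} where
  carrier s := BHom A (TwoU s)
  top s := TopologicalSpace.induced BHom.toFun inferInstance
  rel s x y := ∀ a, kLE s (x.toFun a) (y.toFun a)
  zero s :=
    { toFun := fun _ => alterEgo.zero s
      map_tsup := by cases s <;> exact fun _ _ => rfl
      map_tinf := by cases s <;> exact fun _ _ => rfl
      map_ksup := by cases s <;> exact fun _ _ => rfl
      map_kinf := by cases s <;> exact fun _ _ => rfl }
  one s :=
    { toFun := fun _ => alterEgo.one s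
      map_tsup := by cases s <;> exact fun _ _ => rfl
      map_tinf := by cases s <;> exact fun _ _ => rfl
      map_ksup := by cases s <;> exact fun _ _ => rfl
      map_kinf := by cases s <;> exact fun _ _ => rfl }

theorem isClosed_range_hom (A : Type u) [BilatOps A] (s : Sgn) :
    IsClosed (Set.range (BHom.toFun : BHom A (TwoU s) → A → TwoU s)) := by
  have key : ∀ (op : A → A → A) (op' : TwoU s → TwoU s → TwoU s),
      IsClosed {f : A → TwoU s | ∀ a b, f (op a b) = op' (f a) (f b)} := by
    intro op op'
    simp only [Set.ofPred_forall]
    exact isClosed_iInter fun a => isClosed_iInter fun b => isClosed_eq (continuous_apply _)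
      (continuous_op op' (continuous_apply a) (continuous_apply b))
  have h := ((key tsup tsup).inter (key tinf tinf)).inter ((key ksup ksup).inter (key kinf kinf))
  convert h using 1
  ext f
  constructor
  · rintro ⟨g, rfl⟩
    exact ⟨⟨g.map_tsup, g.map_tinf⟩, ⟨g.map_ksup, g.map_kinf⟩⟩
  · rintro ⟨⟨h1, h2⟩, ⟨h3, h4⟩⟩
    exact ⟨⟨f, h1, h2, h3, h4⟩, rfl⟩

/-- The hom-set as a closed substructure of the power with exponent `A`. -/
def homClosedSub (A : Type u) [BilatOps A] [Nonempty A] : ClosedSub (power A) where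
  sets s := Set.range (BHom.toFun : BHom A (TwoU s) → A → TwoU s)
  closed s := isClosed_range_hom A s
  zero_mem s := ⟨(homStruct A).zero s, rfl⟩
  one_mem s := ⟨(homStruct A).one s, rfl⟩

/-- The identification of the hom-set with that closed substructure. -/
def homToClosedSub (A : Type u) [BilatOps A] [Nonempty A] :
    TSHom (homStruct A) (homClosedSub A).toStruct where
  toFun _ x := ⟨x.toFun, x, rfl⟩
  cont _ := continuous_induced_rng.2 continuous_induced_dom
  map_rel _ _ _ h := h
  map_zero _ := rfl
  map_one _ := rfl

/-- The inverse identification. -/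
noncomputable def homOfClosedSub (A : Type u) [BilatOps A] [Nonempty A] :
    TSHom (homClosedSub A).toStruct (homStruct A) where
  toFun _ x := x.2.choose
  cont s := by
    refine continuous_induced_rng.2 ?_
    have h : Continuous (Subtype.val : {f // f ∈ Set.range
        (BHom.toFun : BHom A (TwoU s) → A → TwoU s)} → A → TwoU s) := continuous_subtype_val
    exact h.congr fun x => x.2.choose_spec.symm
  map_rel s x y h := by
    intro a
    have hx := x.2.choose_spec
    have hy := y.2.choose_spec
    rw [hx, hy]
    exact h a
  map_zero s := BHom.ext (((homClosedSub A).toStruct.zero s).2.choose_spec)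
  map_one s := BHom.ext (((homClosedSub A).toStruct.one s).2.choose_spec)

theorem iscp_homStruct (A : Type u) [BilatOps A] [Nonempty A] : iscpClass (homStruct A) := by
  refine ⟨A, inferInstance, homClosedSub A, ⟨⟨homToClosedSub A, homOfClosedSub A, ?_, ?_⟩⟩⟩
  · refine TSHom.ext (funext fun s => funext fun x => BHom.ext ?_)
    exact Exists.choose_spec (⟨x, rfl⟩ : ∃ y : BHom A (TwoU s), y.toFun = x.toFun)
  · refine TSHom.ext (funext fun s => funext fun x => Subtype.ext ?_)
    exact x.2.choose_spec

/-- The functor `D`, sending `A` to its two-sorted hom-set and acting by composition. -/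
def dualD : DPBu.{u}ᵒᵖ ⥤ DualCat.{u} where
  obj A := ⟨homStruct A.unop.obj.carrier, iscp_homStruct _⟩
  map {A B} f := ObjectProperty.homMk
    (show TSHom (homStruct A.unop.obj.carrier) (homStruct B.unop.obj.carrier) from
      { toFun := fun s x => BHom.comp x f.unop.hom
        cont := fun s => continuous_induced_rng.2 (continuous_pi fun b =>
          (continuous_apply (BHom.toFun f.unop.hom b)).comp continuous_induced_dom)
        map_rel := fun s x y h b => h _
        map_zero := fun s => rfl
        map_one := fun s => rfl })

theorem rel_op {s : Sgn} {a b c d : TwoU s} (h : kLE s a b) (h' : kLE s c d) :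
    kLE s (tsup a c) (tsup b d) ∧ kLE s (tinf a c) (tinf b d) ∧
      kLE s (ksup a c) (ksup b d) ∧ kLE s (kinf a c) (kinf b d) := by
  revert a b c d
  cases s <;> unfold kLE <;> decide

/-- The morphisms from `X` to the alter ego, with pointwise operations: a subalgebra of the product
`(2_u^+)^{X_+} × (2_u^-)^{X_-}`. -/
instance homOps (X : TSStruct.{u}) : BilatOps (TSHom X alterEgo) where
  tsup f g :=
    { toFun := fun s x => tsup (A := TwoU s) (f.toFun s x) (g.toFun s x)
      cont := fun s => continuous_op (s := s) _ (f.cont s) (g.cont s)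
      map_rel := fun s x y h => (rel_op (f.map_rel s x y h) (g.map_rel s x y h)).1
      map_zero := fun s => by rw [f.map_zero, g.map_zero]; cases s <;> rfl
      map_one := fun s => by rw [f.map_one, g.map_one]; cases s <;> rfl }
  tinf f g :=
    { toFun := fun s x => tinf (A := TwoU s) (f.toFun s x) (g.toFun s x)
      cont := fun s => continuous_op (s := s) _ (f.cont s) (g.cont s)
      map_rel := fun s x y h => (rel_op (f.map_rel s x y h) (g.map_rel s x y h)).2.1
      map_zero := fun s => by rw [f.map_zero, g.map_zero]; cases s <;> rfl
      map_one := fun s => by rw [f.map_one, g.map_one]; cases s <;> rfl }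
  ksup f g :=
    { toFun := fun s x => ksup (A := TwoU s) (f.toFun s x) (g.toFun s x)
      cont := fun s => continuous_op (s := s) _ (f.cont s) (g.cont s)
      map_rel := fun s x y h => (rel_op (f.map_rel s x y h) (g.map_rel s x y h)).2.2.1
      map_zero := fun s => by rw [f.map_zero, g.map_zero]; cases s <;> rfl
      map_one := fun s => by rw [f.map_one, g.map_one]; cases s <;> rfl }
  kinf f g :=
    { toFun := fun s x => kinf (A := TwoU s) (f.toFun s x) (g.toFun s x)
      cont := fun s => continuous_op (s := s) _ (f.cont s) (g.cont s)
      map_rel := fun s x y h => (rel_op (f.map_rel s x y h) (g.map_rel s x y h)).2.2.2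
      map_zero := fun s => by rw [f.map_zero, g.map_zero]; cases s <;> rfl
      map_one := fun s => by rw [f.map_one, g.map_one]; cases s <;> rfl }

theorem nonempty_hom {X : TSStruct.{u}} (hX : iscpClass X) : Nonempty (TSHom X alterEgo) := by
  obtain ⟨S, ⟨i⟩, C, ⟨φ⟩⟩ := hX
  let p : TSHom C.toStruct alterEgo :=
    { toFun := fun s x => x.1 i
      cont := fun s => (continuous_apply i).comp continuous_subtype_val
      map_rel := fun s x y h => h i
      map_zero := fun s => rfl
      map_one := fun s => rfl }
  exact ⟨TSHom.comp p φ.hom⟩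

theorem isUnboundedDPB_hom (X : TSStruct.{u}) : IsUnboundedDPB (TSHom X alterEgo) := by
  have h := isUnboundedDPB_twoU
  constructor
  · constructor <;> intros <;> refine TSHom.ext (funext fun s => funext fun x => ?_)
    exacts [(h s).t_lattice.join_comm _ _, (h s).t_lattice.meet_comm _ _,
      (h s).t_lattice.join_assoc _ _ _, (h s).t_lattice.meet_assoc _ _ _,
      (h s).t_lattice.join_absorb _ _, (h s).t_lattice.meet_absorb _ _]
  · constructor <;> intros <;> refine TSHom.ext (funext fun s => funext fun x => ?_)
    exacts [(h s).k_lattice.join_comm _ _, (h s).k_lattice.meet_comm _ _,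
      (h s).k_lattice.join_assoc _ _ _, (h s).k_lattice.meet_assoc _ _ _,
      (h s).k_lattice.join_absorb _ _, (h s).k_lattice.meet_absorb _ _]
  all_goals
    intro a b c
    refine TSHom.ext (funext fun s => funext fun x => ?_)
  exacts [(h s).tsup_tinf _ _ _, (h s).tsup_ksup _ _ _, (h s).tsup_kinf _ _ _,
    (h s).tinf_tsup _ _ _, (h s).tinf_ksup _ _ _, (h s).tinf_kinf _ _ _,
    (h s).ksup_tsup _ _ _, (h s).ksup_tinf _ _ _, (h s).ksup_kinf _ _ _,
    (h s).kinf_tsup _ _ _, (h s).kinf_tinf _ _ _, (h s).kinf_ksup _ _ _]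

/-- The functor `E`, sending `X` to its algebra of morphisms to the alter ego and acting by
composition. -/
def dualE : DualCat.{u}ᵒᵖ ⥤ DPBu.{u} where
  obj X := ⟨{ carrier := TSHom X.unop.obj alterEgo, nonempty := nonempty_hom X.unop.property },
    isUnboundedDPB_hom _⟩
  map {X Y} f := ObjectProperty.homMk
    (show BHom (TSHom X.unop.obj alterEgo) (TSHom Y.unop.obj alterEgo) from
      { toFun := fun g => TSHom.comp g f.unop.hom
        map_tsup := fun _ _ => rfl
        map_tinf := fun _ _ => rfl
        map_ksup := fun _ _ => rfl
        map_kinf := fun _ _ => rfl })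

/-- The evaluation homomorphism `e_A : A → E D(A)`, `e_A(a)(x) = x(a)`. -/
def evalAlg (A : DPBu.{u}) : A ⟶ dualE.obj (op (dualD.obj (op A))) :=
  ObjectProperty.homMk
    (show BHom A.obj.carrier (TSHom (homStruct A.obj.carrier) alterEgo) from
      { toFun := fun a =>
          { toFun := fun s (x : BHom A.obj.carrier (TwoU s)) => x.toFun a
            cont := fun s => (continuous_apply a).comp continuous_induced_dom
            map_rel := fun s x y h => h a
            map_zero := fun s => rfl
            map_one := fun s => rfl }
        map_tsup := fun a b => TSHom.ext (funext fun s => funext fun x => BHom.map_tsup x a b)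
        map_tinf := fun a b => TSHom.ext (funext fun s => funext fun x => BHom.map_tinf x a b)
        map_ksup := fun a b => TSHom.ext (funext fun s => funext fun x => BHom.map_ksup x a b)
        map_kinf := fun a b => TSHom.ext (funext fun s => funext fun x => BHom.map_kinf x a b) })

/-- The evaluation morphism `ε_X : X → D E(X)`, `ε_X(x)(f) = f(x)`. -/
def evalSpace (X : DualCat.{u}) : X ⟶ dualD.obj (op (dualE.obj (op X))) :=
  ObjectProperty.homMk
    (haveI : Nonempty (TSHom X.obj alterEgo) := nonempty_hom X.property
     show TSHom X.obj (homStruct (TSHom X.obj alterEgo)) from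
      { toFun := fun s x =>
          { toFun := fun f => f.toFun s x
            map_tsup := fun _ _ => rfl
            map_tinf := fun _ _ => rfl
            map_ksup := fun _ _ => rfl
            map_kinf := fun _ _ => rfl }
        cont := fun s => continuous_induced_rng.2 (continuous_pi fun f => f.cont s)
        map_rel := fun s x y h f => f.map_rel s x y h
        map_zero := fun s => BHom.ext (funext fun f => f.map_zero s)
        map_one := fun s => BHom.ext (funext fun f => f.map_one s) })

/-! ### Dualities, full dualities and strong dualities -/

/-- The alter ego yields a duality: every `e_A` is an isomorphism. -/
def YieldsDuality : Prop := ∀ A : DPBu.{u}, IsIso (evalAlg A)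

/-- The alter ego yields a full duality: moreover every `ε_X` is an isomorphism. -/
def YieldsFullDuality : Prop := YieldsDuality.{u} ∧ ∀ X : DualCat.{u}, IsIso (evalSpace X)

/-- Terms in the operations `∨_t, ∧_t, ∨_k, ∧_k` with variables from `S`. -/
inductive BTerm (S : Type u) : Type u
  | var : S → BTerm S
  | tsup : BTerm S → BTerm S → BTerm S
  | tinf : BTerm S → BTerm S → BTerm S
  | ksup : BTerm S → BTerm S → BTerm S
  | kinf : BTerm S → BTerm S → BTerm S

/-- The value of a term at an assignment of its variables. -/
def BTerm.eval {S : Type u} {A : Type v} [BilatOps A] (y : S → A) : BTerm S → A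
  | .var i => y i
  | .tsup p q => BilatOps.tsup (p.eval y) (q.eval y)
  | .tinf p q => BilatOps.tinf (p.eval y) (q.eval y)
  | .ksup p q => BilatOps.ksup (p.eval y) (q.eval y)
  | .kinf p q => BilatOps.kinf (p.eval y) (q.eval y)

/-- A closed substructure of a power is term-closed if every point outside it is separated from it by
a pair of terms that agree on it, in both sorts. -/
def ClosedSub.TermClosed {S : Type u} (C : ClosedSub (power S)) : Prop :=
  ∀ (s : Sgn) (y : S → TwoU s), y ∉ C.sets s →
    ∃ p q : BTerm S, (∀ (r : Sgn), ∀ x ∈ C.sets r, p.eval (A := TwoU r) x = q.eval x) ∧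
      p.eval y ≠ q.eval y

/-- Embeddings: isomorphisms onto a substructure. -/
structure TSHom.IsEmb {X : TSStruct.{u}} {Y : TSStruct.{v}} (φ : TSHom X Y) : Prop where
  emb : ∀ s, Topology.IsEmbedding (φ.toFun s)
  reflect : ∀ s x y, Y.rel s (φ.toFun s x) (φ.toFun s y) → X.rel s x y

/-- The alter ego is injective (with respect to embeddings) in the dual category. -/
def AlterEgoInjective : Prop :=
  ∀ (X Y : TSStruct.{u}), iscpClass X → iscpClass Y → ∀ φ : TSHom X Y, φ.IsEmb →
    ∀ α : TSHom X alterEgo, ∃ β : TSHom Y alterEgo, β.comp φ = α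

/-- The alter ego yields a strong duality: it yields a duality, and every closed substructure of a
non-empty power is term-closed. The last field is the other customary form of strongness,
injectivity of the alter ego in the dual category; both forms are demanded. -/
structure YieldsStrongDuality : Prop where
  duality : YieldsDuality.{u}
  termClosed : ∀ (S : Type u) [Nonempty S] (C : ClosedSub (power S)), C.TermClosed
  injective : AlterEgoInjective.{u}

end PreBilattice

namespace PreBilattice

open BilatOps

/-! ### Characters of the truth lattice -/

/-! Everything rests on the distributive truth lattice. Its characters, maps to the chain `0 < 1`,
separate points by the prime ideal theorem. Because meet and join distribute over the knowledge
operations, the kernel of a character is a congruence for those too (`character_congr`). The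
quotient has two elements, and idempotence, commutativity and absorption leave its knowledge lattice
only two shapes: the chain or its dual. So each character is a homomorphism to `2_u^+` or `2_u^-`,
which gives the generation theorem.

The duality and injectivity are both instances of one interpolation statement,
`surjective_of_separates`: a subalgebra of E(X), with X compact, that separates points and
determines the relations is all of E(X). Compactness reduces this to separating a point where a
morphism is 1 from a point where it is 0. Within one sort the relation does it; across sorts a
knowledge operation does, being a join on one sort and a meet on the other.

The term `bandOp` is the first projection on `2_u^+` and the second on `2_u^-`, so the two sorts can
be treated independently. It confines a separating pair of lattice terms to one sort, which yields
term-closedness. Applied to the image of X in the power with exponent E(X), term-closedness makes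
evaluation onto, hence the duality full.

The equivalence needs no topology: the identities of a rectangular band hold for `bandOp` because
homomorphisms to the two generators separate points, and they split every algebra as a product of
two lattices, one with its knowledge order reversed. -/

/-- The truth lattice of an unbounded distributive pre-bilattice. -/
abbrev IsUnboundedDPB.tLattice {A : Type u} [BilatOps A] (h : IsUnboundedDPB A) :
    DistribLattice A :=
  letI : Max A := ⟨tsup⟩
  letI : Min A := ⟨tinf⟩
  letI : Lattice A := Lattice.mk' h.t_lattice.join_comm h.t_lattice.join_assoc
    h.t_lattice.meet_comm h.t_lattice.meet_assoc h.t_lattice.join_absorb h.t_lattice.meet_absorb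
  DistribLattice.ofInfSupLe fun a b c => (h.tinf_tsup a b c).le

theorem IsLatticePair.join_self {A : Type u} {j m : A → A → A} (h : IsLatticePair j m) (a : A) :
    j a a = a :=
  calc j a a = j a (m a (j a a)) := by rw [h.meet_absorb]
    _ = a := h.join_absorb a _

theorem IsLatticePair.symm {A : Type u} {j m : A → A → A} (h : IsLatticePair j m) :
    IsLatticePair m j :=
  ⟨h.meet_comm, h.join_comm, h.meet_assoc, h.join_assoc, h.meet_absorb, h.join_absorb⟩

/-- A lattice character is compatible with every commutative operation over which join and meet
distribute. -/
theorem character_congr {A : Type u} [Lattice A] (χ : LatticeHom A Bool) (op : A → A → A)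
    (hcomm : ∀ a b, op a b = op b a)
    (hinf : ∀ a b c, a ⊓ op b c = op (a ⊓ b) (a ⊓ c))
    (hsup : ∀ a b c, a ⊔ op b c = op (a ⊔ b) (a ⊔ c))
    {x x' y y' : A} (hx : χ x = χ x') (hy : χ y = χ y') : χ (op x y) = χ (op x' y') := by
  have key : ∀ {x x' : A} (y : A), χ x = χ x' → χ (op x y) = χ (op x' y) := by
    intro x x' y h
    cases hc : χ x with
    | true =>
      -- Meeting with `x ⊓ x'` erases the difference between `x` and `x'`; since `χ` is 1 there, the
      -- meet does not change values of `χ`.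
      have e : (x ⊓ x') ⊓ op x y = (x ⊓ x') ⊓ op x' y := by
        rw [hinf, hinf, inf_eq_left.2 (inf_le_left : x ⊓ x' ≤ x),
          inf_eq_left.2 (inf_le_right : x ⊓ x' ≤ x')]
      have := congrArg χ e
      simpa [map_inf, ← h, hc] using this
    | false =>
      have e : (x ⊔ x') ⊔ op x y = (x ⊔ x') ⊔ op x' y := by
        rw [hsup, hsup, sup_eq_left.2 (le_sup_left : x ≤ x ⊔ x'),
          sup_eq_left.2 (le_sup_right : x' ≤ x ⊔ x')]
      have := congrArg χ e
      simpa [map_sup, ← h, hc] using this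
  rw [key y hx, hcomm, key x' hy, hcomm]

/-- Every character of the truth lattice is a homomorphism to `2_u^+` or to `2_u^-`. -/
theorem IsUnboundedDPB.exists_hom_of_character {A : Type u} [BilatOps A] (h : IsUnboundedDPB A)
    (χ : A → Bool) (hsup : ∀ a b, χ (tsup a b) = (χ a || χ b))
    (hinf : ∀ a b, χ (tinf a b) = (χ a && χ b)) :
    ∃ (s : Sgn) (f : BHom A (TwoU s)), ∀ a, f.toFun a = χ a := by
  let _ := h.tLattice
  let χ' : LatticeHom A Bool := { toFun := χ, map_sup' := hsup, map_inf' := hinf }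
  have cj : ∀ {x x' y y' : A}, χ x = χ x' → χ y = χ y' → χ (ksup x y) = χ (ksup x' y') :=
    character_congr χ' ksup h.k_lattice.join_comm h.tinf_ksup h.tsup_ksup
  have cm : ∀ {x x' y y' : A}, χ x = χ x' → χ y = χ y' → χ (kinf x y) = χ (kinf x' y') :=
    character_congr χ' kinf h.k_lattice.meet_comm h.tinf_kinf h.tsup_kinf
  have ij : ∀ {x y : A}, χ x = χ y → χ (ksup x y) = χ y := fun {x y} e => by
    rw [cj e rfl, h.k_lattice.join_self]
  have im : ∀ {x y : A}, χ x = χ y → χ (kinf x y) = χ y := fun {x y} e => by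
    rw [cm e rfl, h.k_lattice.symm.join_self]
  -- On arguments with equal values both operations are fixed by idempotence, and by `cj` the value
  -- of the join at (1, 0) does not depend on representatives. That single bit chooses the sort;
  -- absorption then forces the knowledge meet.
  by_cases c : ∃ x y, χ x = true ∧ χ y = false ∧ χ (ksup x y) = false
  · obtain ⟨x, y, hx, hy, hxy⟩ := c
    have hj : ∀ {a b}, χ a = true → χ b = false → χ (ksup a b) = false := fun ha hb => by
      rw [cj (ha.trans hx.symm) (hb.trans hy.symm), hxy]
    have hm : ∀ {a b}, χ a = true → χ b = false → χ (kinf a b) = true := fun {a b} ha hb => by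
      by_contra hc
      have := hj ha (Bool.eq_false_iff.2 hc)
      rw [h.k_lattice.join_absorb, ha] at this
      cases this
    refine ⟨.neg, ⟨χ, hsup, hinf, fun a b => ?_, fun a b => ?_⟩, fun a => rfl⟩
    · change χ (ksup a b) = (χ a && χ b)
      cases ha : χ a <;> cases hb : χ b
      · exact (ij (ha.trans hb.symm)).trans hb
      · rw [h.k_lattice.join_comm]; exact hj hb ha
      · exact hj ha hb
      · exact (ij (ha.trans hb.symm)).trans hb
    · change χ (kinf a b) = (χ a || χ b)
      cases ha : χ a <;> cases hb : χ b
      · exact (im (ha.trans hb.symm)).trans hb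
      · rw [h.k_lattice.meet_comm]; exact hm hb ha
      · exact hm ha hb
      · exact (im (ha.trans hb.symm)).trans hb
  · have hj : ∀ {a b}, χ a = true → χ b = false → χ (ksup a b) = true := fun {a b} ha hb => by
      by_contra hc
      exact c ⟨a, b, ha, hb, Bool.eq_false_iff.2 hc⟩
    have hm : ∀ {a b}, χ a = true → χ b = false → χ (kinf a b) = false := fun {a b} ha hb => by
      by_contra hc
      have := hj (Bool.eq_true_of_not_eq_false hc) hb
      rw [h.k_lattice.join_comm, h.k_lattice.meet_comm, h.k_lattice.join_absorb, hb] at this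
      cases this
    refine ⟨.pos, ⟨χ, hsup, hinf, fun a b => ?_, fun a b => ?_⟩, fun a => rfl⟩
    · change χ (ksup a b) = (χ a || χ b)
      cases ha : χ a <;> cases hb : χ b
      · exact (ij (ha.trans hb.symm)).trans hb
      · rw [h.k_lattice.join_comm]; exact hj hb ha
      · exact hj ha hb
      · exact (ij (ha.trans hb.symm)).trans hb
    · change χ (kinf a b) = (χ a && χ b)
      cases ha : χ a <;> cases hb : χ b
      · exact (im (ha.trans hb.symm)).trans hb
      · rw [h.k_lattice.meet_comm]; exact hm hb ha
      · exact hm ha hb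
      · exact (im (ha.trans hb.symm)).trans hb

/-- The prime ideal theorem, in terms of characters. -/
theorem exists_character_of_not_le {A : Type u} [DistribLattice A] {a b : A} (hab : ¬ a ≤ b) :
    ∃ χ : LatticeHom A Bool, χ a = true ∧ χ b = false := by
  have hd : Disjoint (Order.PFilter.principal a : Set A) (Order.Ideal.principal b : Set A) :=
    Set.disjoint_left.2 fun x hx hx' =>
      hab ((Order.PFilter.mem_principal.1 hx).trans (Order.Ideal.mem_principal.1 hx'))
  obtain ⟨J, hJ, hI, hF⟩ := DistribLattice.prime_ideal_of_disjoint_filter_ideal hd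
  classical
  -- The character is the indicator of the prime filter complementary to `J`.
  refine ⟨⟨⟨fun x => decide (x ∉ J), fun x y => ?_⟩, fun x y => ?_⟩, ?_, ?_⟩
  · change decide _ = (decide _ || decide _)
    rw [← Bool.decide_or, decide_eq_decide, Order.Ideal.sup_mem_iff]
    tauto
  · change decide _ = (decide _ && decide _)
    rw [← Bool.decide_and, decide_eq_decide]
    constructor
    · exact fun hn => ⟨fun hx => hn (J.lower inf_le_left hx), fun hy => hn (J.lower inf_le_right hy)⟩
    · rintro ⟨hx, hy⟩ hxy
      exact (hJ.mem_or_mem hxy).elim hx hy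
  · exact decide_eq_true (Set.disjoint_left.1 hF (Order.PFilter.mem_principal.2 le_rfl))
  · exact decide_eq_false (not_not.2 (hI (Order.Ideal.mem_principal.2 le_rfl)))

/-- Homomorphisms to `2_u^+` and `2_u^-` separate the points. -/
theorem IsUnboundedDPB.eq_of_forall_hom {A : Type u} [BilatOps A] (h : IsUnboundedDPB A) {a b : A}
    (hab : ∀ s (f : BHom A (TwoU s)), f.toFun a = f.toFun b) : a = b := by
  let _ := h.tLattice
  have key : ∀ {a b : A}, (∀ s (f : BHom A (TwoU s)), f.toFun a = f.toFun b) → a ≤ b := by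
    intro a b hab
    by_contra hle
    obtain ⟨χ, ha, hb⟩ := exists_character_of_not_le hle
    obtain ⟨s, f, hf⟩ := h.exists_hom_of_character χ (map_sup χ) (map_inf χ)
    have := hab s f
    rw [hf, hf, ha, hb] at this
    cases this
  exact le_antisymm (key hab) (key fun s f => (hab s f).symm)

/-! ### The generation theorem -/

theorem IsUnboundedDPB.pi {I : Type u} {B : I → Type v} [∀ i, BilatOps (B i)]
    (h : ∀ i, IsUnboundedDPB (B i)) : IsUnboundedDPB (∀ i, B i) := by
  constructor
  · constructor <;> intros <;> refine funext fun i => ?_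
    exacts [(h i).t_lattice.join_comm _ _, (h i).t_lattice.meet_comm _ _,
      (h i).t_lattice.join_assoc _ _ _, (h i).t_lattice.meet_assoc _ _ _,
      (h i).t_lattice.join_absorb _ _, (h i).t_lattice.meet_absorb _ _]
  · constructor <;> intros <;> refine funext fun i => ?_
    exacts [(h i).k_lattice.join_comm _ _, (h i).k_lattice.meet_comm _ _,
      (h i).k_lattice.join_assoc _ _ _, (h i).k_lattice.meet_assoc _ _ _,
      (h i).k_lattice.join_absorb _ _, (h i).k_lattice.meet_absorb _ _]
  all_goals
    intro a b c
    refine funext fun i => ?_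
  exacts [(h i).tsup_tinf _ _ _, (h i).tsup_ksup _ _ _, (h i).tsup_kinf _ _ _,
    (h i).tinf_tsup _ _ _, (h i).tinf_ksup _ _ _, (h i).tinf_kinf _ _ _,
    (h i).ksup_tsup _ _ _, (h i).ksup_tinf _ _ _, (h i).ksup_kinf _ _ _,
    (h i).kinf_tsup _ _ _, (h i).kinf_tinf _ _ _, (h i).kinf_ksup _ _ _]

theorem IsUnboundedDPB.of_injective {A : Type u} {B : Type v} [BilatOps A] [BilatOps B]
    (h : IsUnboundedDPB B) (f : BHom A B) (hf : Function.Injective f.toFun) :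
    IsUnboundedDPB A := by
  constructor
  · constructor <;> intros <;> apply hf <;> simp only [f.map_tsup, f.map_tinf]
    exacts [h.t_lattice.join_comm _ _, h.t_lattice.meet_comm _ _,
      h.t_lattice.join_assoc _ _ _, h.t_lattice.meet_assoc _ _ _,
      h.t_lattice.join_absorb _ _, h.t_lattice.meet_absorb _ _]
  · constructor <;> intros <;> apply hf <;> simp only [f.map_ksup, f.map_kinf]
    exacts [h.k_lattice.join_comm _ _, h.k_lattice.meet_comm _ _,
      h.k_lattice.join_assoc _ _ _, h.k_lattice.meet_assoc _ _ _,
      h.k_lattice.join_absorb _ _, h.k_lattice.meet_absorb _ _]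
  all_goals
    intro a b c
    apply hf
    simp only [f.map_tsup, f.map_tinf, f.map_ksup, f.map_kinf]
  exacts [h.tsup_tinf _ _ _, h.tsup_ksup _ _ _, h.tsup_kinf _ _ _,
    h.tinf_tsup _ _ _, h.tinf_ksup _ _ _, h.tinf_kinf _ _ _,
    h.ksup_tsup _ _ _, h.ksup_tinf _ _ _, h.ksup_kinf _ _ _,
    h.kinf_tsup _ _ _, h.kinf_tinf _ _ _, h.kinf_ksup _ _ _]

/-- For one inclusion, index the product by all homomorphisms into both generators; for the other,
the laws are equations and so pass to products and subalgebras. -/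
theorem dpbClass_eq_ispClass : dpbClass.{u} = ispClass.{u} TwoU := by
  funext A
  refine propext ⟨fun h => ?_, ?_⟩
  · refine ⟨Σ s, BHom A.carrier (TwoU s), Sigma.fst,
      ⟨fun a i => i.2.toFun a, fun a b => funext fun i => i.2.map_tsup a b,
        fun a b => funext fun i => i.2.map_tinf a b, fun a b => funext fun i => i.2.map_ksup a b,
        fun a b => funext fun i => i.2.map_kinf a b⟩, fun a b hab => ?_⟩
    exact IsUnboundedDPB.eq_of_forall_hom h fun s f => congrFun hab ⟨s, f⟩
  · rintro ⟨I, σ, f, hf⟩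
    exact (IsUnboundedDPB.pi fun i => isUnboundedDPB_twoU (σ i)).of_injective f hf

/-! ### Interpolation -/

/-- In a family of continuous two-valued functions closed under joins and meets, separation of the
points of two non-empty compact sets gives separation of the sets. -/
theorem exists_eval_separates {L : Type u} {T : Type v} [TopologicalSpace T] (ev : L → T → Bool)
    (hev : ∀ a, Continuous (ev a)) (hsup : ∀ a b, ∃ c, ∀ x, ev c x = (ev a x || ev b x))
    (hinf : ∀ a b, ∃ c, ∀ x, ev c x = (ev a x && ev b x)) {K Z : Set T} (hK : IsCompact K)
    (hZ : IsCompact Z) (hK' : K.Nonempty) (hZ' : Z.Nonempty)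
    (h : ∀ x ∈ K, ∀ z ∈ Z, ∃ a, ev a x = true ∧ ev a z = false) :
    ∃ a, (∀ x ∈ K, ev a x = true) ∧ ∀ z ∈ Z, ev a z = false := by
  have hopen : ∀ a b, IsOpen {x | ev a x = b} := fun a b =>
    (isOpen_discrete {b}).preimage (hev a)
  have hpoint : ∀ x ∈ K, ∃ a, ev a x = true ∧ ∀ z ∈ Z, ev a z = false := by
    intro x hx
    refine hZ.induction_on (p := fun Z => ∃ a, ev a x = true ∧ ∀ z ∈ Z, ev a z = false)
      ?_ ?_ ?_ ?_
    -- There are no constant functions to start from, so the empty case takes its function from a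
    -- point of the non-empty set.
    · obtain ⟨z, hz⟩ := hZ'
      obtain ⟨a, ha, -⟩ := h x hx z hz
      exact ⟨a, ha, fun _ hz => hz.elim⟩
    · rintro s t hst ⟨a, ha, ha'⟩
      exact ⟨a, ha, fun z hz => ha' z (hst hz)⟩
    · rintro s t ⟨a, ha, ha'⟩ ⟨b, hb, hb'⟩
      obtain ⟨c, hc⟩ := hinf a b
      refine ⟨c, by rw [hc, ha, hb]; rfl, fun z hz => ?_⟩
      rw [hc]
      rcases hz with hz | hz
      · rw [ha' z hz]; rfl
      · rw [hb' z hz, Bool.and_false]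
    · intro z hz
      obtain ⟨a, ha, ha'⟩ := h x hx z hz
      exact ⟨_, mem_nhdsWithin_of_mem_nhds ((hopen a false).mem_nhds ha'), a, ha, fun _ hw => hw⟩
  refine hK.induction_on
    (p := fun K => ∃ a, (∀ x ∈ K, ev a x = true) ∧ ∀ z ∈ Z, ev a z = false) ?_ ?_ ?_ ?_
  · obtain ⟨x, hx⟩ := hK'
    obtain ⟨a, -, ha⟩ := hpoint x hx
    exact ⟨a, fun _ hx => hx.elim, ha⟩
  · rintro s t hst ⟨a, ha, ha'⟩
    exact ⟨a, fun x hx => ha x (hst hx), ha'⟩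
  · rintro s t ⟨a, ha, ha'⟩ ⟨b, hb, hb'⟩
    obtain ⟨c, hc⟩ := hsup a b
    refine ⟨c, fun x hx => ?_, fun z hz => by rw [hc, ha' z hz, hb' z hz]; rfl⟩
    rw [hc]
    rcases hx with hx | hx
    · rw [ha x hx]; rfl
    · rw [hb x hx, Bool.or_true]
  · intro x hx
    obtain ⟨a, ha, ha'⟩ := hpoint x hx
    exact ⟨_, mem_nhdsWithin_of_mem_nhds ((hopen a true).mem_nhds ha), a, fun _ hw => hw, ha'⟩

/-- Makes the disjoint union of two compact sorts compact. -/
theorem finite_sgn : Finite Sgn :=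
  Finite.of_surjective (fun b : Bool => if b then Sgn.pos else Sgn.neg) fun s => by
    cases s
    · exact ⟨true, rfl⟩
    · exact ⟨false, rfl⟩

/-- An algebra of morphisms from a compact structure to the alter ego that separates points and
determines the relations contains all morphisms. -/
theorem surjective_of_separates {L : Type u} [BilatOps L] {X : TSStruct.{v}}
    [∀ s, CompactSpace (X.carrier s)] (ev : BHom L (TSHom X alterEgo))
    (hinj : ∀ s x y, (∀ a, (ev.toFun a).toFun s x = (ev.toFun a).toFun s y) → x = y)
    (hrel : ∀ s x y, (∀ a, kLE s ((ev.toFun a).toFun s x) ((ev.toFun a).toFun s y)) →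
      X.rel s x y) :
    Function.Surjective ev.toFun := by
  intro α
  have := finite_sgn
  let value (f : TSHom X alterEgo) (x : Σ s, X.carrier s) : Bool := f.toFun x.1 x.2
  have hcont (f : TSHom X alterEgo) : Continuous (value f) := continuous_sigma fun s => f.cont s
  -- Every morphism sends `X.zero s` to 0, so a point at which all members of the algebra vanish is
  -- that constant, where `α` vanishes too.
  have hone : ∀ s x, α.toFun s x = true → ∃ a, (ev.toFun a).toFun s x = true := by
    intro s x hx
    by_contra! hc
    have : x = X.zero s := hinj s _ _ fun a =>
      (Bool.eq_false_iff.2 (hc a)).trans ((ev.toFun a).map_zero s).symm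
    rw [this, α.map_zero] at hx
    cases hx
  have hzero : ∀ s x, α.toFun s x = false → ∃ a, (ev.toFun a).toFun s x = false := by
    intro s x hx
    by_contra! hc
    have : x = X.one s := hinj s _ _ fun a =>
      (Bool.eq_true_of_not_eq_false (hc a)).trans ((ev.toFun a).map_one s).symm
    rw [this, α.map_one] at hx
    cases hx
  -- Interpolation takes place on the disjoint union of the sorts, where the truth operations are
  -- Boolean join and meet throughout. The constants make both fibres of `α` non-empty.
  obtain ⟨a, ha, ha'⟩ := exists_eval_separates (fun a => value (ev.toFun a)) (fun a => hcont _)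
    (fun a b => ⟨tsup a b, fun x => by
      rw [ev.map_tsup]
      rcases x with ⟨s, x⟩
      cases s <;> rfl⟩)
    (fun a b => ⟨tinf a b, fun x => by
      rw [ev.map_tinf]
      rcases x with ⟨s, x⟩
      cases s <;> rfl⟩)
    (K := value α ⁻¹' {true}) (Z := value α ⁻¹' {false})
    ((isClosed_discrete _).preimage (hcont α)).isCompact
    ((isClosed_discrete _).preimage (hcont α)).isCompact
    ⟨⟨.pos, X.one .pos⟩, α.map_one .pos⟩ ⟨⟨.pos, X.zero .pos⟩, α.map_zero .pos⟩ (by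
      rintro ⟨s, x⟩ hx ⟨r, z⟩ hz
      change α.toFun s x = true at hx
      change α.toFun r z = false at hz
      by_cases hsr : s = r
      · subst hsr
        by_contra! hc
        have hc' : ∀ a, (ev.toFun a).toFun s x = true → (ev.toFun a).toFun s z = true :=
          fun a hx => Bool.eq_true_of_not_eq_false (hc a hx)
        cases s with
        | pos =>
          have := α.map_rel _ _ _ (hrel .pos x z fun a => by
            have := hc' a
            change (Bool.and _ _) = _
            revert this
            generalize (ev.toFun a).toFun .pos x = p
            generalize (ev.toFun a).toFun .pos z = q
            revert p q
            change ∀ p q : Bool, (p = true → q = true) → Bool.and p q = p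
            decide)
          change Bool.and _ _ = _ at this
          rw [hx, hz] at this
          cases this
        | neg =>
          -- The roles of `x` and `z` are exchanged because the knowledge order is reversed in this
          -- sort.
          have := α.map_rel _ _ _ (hrel .neg z x fun a => by
            have := hc' a
            change (Bool.or _ _) = _
            revert this
            generalize (ev.toFun a).toFun .neg x = p
            generalize (ev.toFun a).toFun .neg z = q
            revert p q
            change ∀ p q : Bool, (p = true → q = true) → Bool.or q p = q
            decide)
          change Bool.or _ _ = _ at this
          rw [hx, hz] at this
          cases this
      · obtain ⟨b, hb⟩ := hone s x hx
        obtain ⟨c, hc⟩ := hzero r z hz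
        cases s <;> cases r
        · exact absurd rfl hsr
        -- At the positive point this is a join with `b = 1`; at the negative point it is a meet
        -- with `c = 0`. In the opposite case `kinf` plays this role.
        · refine ⟨ksup b c, ?_⟩
          rw [ev.map_ksup]
          change Bool.or _ _ = true ∧ Bool.and _ _ = false
          rw [hb, hc]
          exact ⟨rfl, Bool.and_false _⟩
        · refine ⟨kinf b c, ?_⟩
          rw [ev.map_kinf]
          change Bool.or _ _ = true ∧ Bool.and _ _ = false
          rw [hb, hc]
          exact ⟨rfl, Bool.and_false _⟩
        · exact absurd rfl hsr)
  refine ⟨a, TSHom.ext (funext fun s => funext fun x => ?_)⟩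
  cases hx : α.toFun s x
  · exact ha' ⟨s, x⟩ hx
  · exact ha ⟨s, x⟩ hx

/-! ### Structures in the dual category -/

theorem TSHom.isEmb_of_comp_eq_id {X Y : TSStruct.{u}} (f : TSHom X Y) (g : TSHom Y X)
    (h : g.comp f = TSHom.id X) : f.IsEmb := by
  have h' (s x) : g.toFun s (f.toFun s x) = x := congrFun (congrFun (congrArg TSHom.toFun h) s) x
  refine ⟨fun s => ?_, fun s x y hxy => ?_⟩
  · refine .of_comp (f.cont s) (g.cont s) ?_
    rw [show g.toFun s ∘ f.toFun s = _root_.id from funext (h' s)]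
    exact .id
  · have := g.map_rel s _ _ hxy
    rwa [h', h'] at this

/-- Members of the dual category embed as closed substructures in non-empty powers. -/
theorem iscpClass.exists_isEmb {X : TSStruct.{u}} (hX : iscpClass X) :
    ∃ (S : Type u) (_ : Nonempty S) (f : TSHom X (power S)), f.IsEmb ∧
      ∀ s, Topology.IsClosedEmbedding (f.toFun s) := by
  obtain ⟨S, hS, C, ⟨φ⟩⟩ := hX
  have hφ := TSHom.isEmb_of_comp_eq_id φ.hom φ.inv φ.hom_inv_id
  have hv (s) : Topology.IsClosedEmbedding (Subtype.val : C.sets s → (power S).carrier s) :=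
    (C.closed s).isClosedEmbedding_subtypeVal
  let incl : TSHom C.toStruct (power S) :=
    { toFun := fun s x => x.1
      cont := fun s => (hv s).continuous
      map_rel := fun s x y h => h
      map_zero := fun s => rfl
      map_one := fun s => rfl }
  have hr (s) : Function.Surjective (φ.hom.toFun s) := fun y =>
    ⟨φ.inv.toFun s y, congrFun (congrFun (congrArg TSHom.toFun φ.inv_hom_id) s) y⟩
  have hφc (s) : Topology.IsClosedEmbedding (φ.hom.toFun s) :=
    ⟨hφ.emb s, by rw [(hr s).range_eq]; exact isClosed_univ⟩
  exact ⟨S, hS, incl.comp φ.hom, ⟨fun s => ((hv s).comp (hφc s)).isEmbedding,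
    fun s x y h => hφ.reflect s x y h⟩, fun s => (hv s).comp (hφc s)⟩

theorem iscpClass.compactSpace {X : TSStruct.{u}} (hX : iscpClass X) (s : Sgn) :
    CompactSpace (X.carrier s) := by
  obtain ⟨S, _, f, -, hf⟩ := hX.exists_isEmb
  have : CompactSpace ((power S).carrier s) := inferInstanceAs (CompactSpace (S → TwoU s))
  exact (hf s).compactSpace

/-- The coordinate projections of a power. -/
def power.proj {S : Type u} (i : S) : TSHom (power S) alterEgo where
  toFun _ x := x i
  cont _ := continuous_apply i
  map_rel _ _ _ h := h i
  map_zero _ := rfl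
  map_one _ := rfl

/-- The coordinates of an embedding into a power already suffice. -/
theorem iscpClass.eq_of_forall_hom {X : TSStruct.{u}} (hX : iscpClass X) {s : Sgn}
    {x y : X.carrier s} (h : ∀ f : TSHom X alterEgo, f.toFun s x = f.toFun s y) : x = y := by
  obtain ⟨S, _, f, -, hf⟩ := hX.exists_isEmb
  exact (hf s).injective (funext fun i => h ((power.proj i).comp f))

theorem iscpClass.rel_of_forall_hom {X : TSStruct.{u}} (hX : iscpClass X) {s : Sgn}
    {x y : X.carrier s} (h : ∀ f : TSHom X alterEgo, kLE s (f.toFun s x) (f.toFun s y)) :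
    X.rel s x y := by
  obtain ⟨S, _, f, hf, -⟩ := hX.exists_isEmb
  exact hf.reflect s x y fun i => h ((power.proj i).comp f)

/-! ### Duality and injectivity -/

theorem BHom.bijective_isIso {A B : BAlg.{u}} (f : A ⟶ B) (hf : Function.Bijective (BHom.toFun f)) :
    IsIso f := by
  obtain ⟨g, hl, hr⟩ := Function.bijective_iff_has_inverse.1 hf
  refine ⟨(show BHom B.carrier A.carrier from ⟨g, ?_, ?_, ?_, ?_⟩), BHom.ext (funext hl),
    BHom.ext (funext hr)⟩ <;>
  · intro a b
    apply hf.1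
    first | rw [BHom.map_tsup f] | rw [BHom.map_tinf f] | rw [BHom.map_ksup f] | rw [BHom.map_kinf f]
    rw [hr, hr, hr]

/-- Injectivity is separation by homomorphisms. For surjectivity the interpolation hypotheses hold
by definition, since the points of D(A) are functions on A related pointwise. -/
theorem yieldsDuality : YieldsDuality.{u} := by
  intro A
  rw [← ObjectProperty.isIso_hom_iff]
  have : ∀ s, CompactSpace ((homStruct A.obj.carrier).carrier s) :=
    (iscp_homStruct A.obj.carrier).compactSpace
  refine BHom.bijective_isIso _ ⟨fun a b hab => ?_, ?_⟩
  · exact IsUnboundedDPB.eq_of_forall_hom A.property fun s f =>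
      congrFun (congrFun (congrArg TSHom.toFun hab) s) f
  · exact surjective_of_separates (L := A.obj.carrier) (X := homStruct A.obj.carrier)
      (evalAlg A).hom (fun s x y h => BHom.ext (funext h)) fun s x y h => h

/-- Restriction along `φ` is a homomorphism from E(Y) to E(X). As `φ` is an embedding, the
restrictions separate points and determine the relations of X, so interpolation makes every `α` a
restriction. -/
theorem alterEgoInjective : AlterEgoInjective.{u} := by
  intro X Y hX hY φ hφ α
  have := hX.compactSpace
  exact surjective_of_separates (L := TSHom Y alterEgo) (X := X)
    ⟨fun f => f.comp φ, fun _ _ => rfl, fun _ _ => rfl, fun _ _ => rfl, fun _ _ => rfl⟩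
    (fun s x y h => (hφ.emb s).injective (hY.eq_of_forall_hom h))
    (fun s x y h => hφ.reflect s x y (hY.rel_of_forall_hom h)) α

/-! ### Term-closedness -/

/-- A term that is the first projection on `2_u^+` and the second projection on `2_u^-`. -/
def bandOp {A : Type u} [BilatOps A] (a b : A) : A :=
  tinf (kinf a (tsup a b)) (ksup b (tsup a b))

theorem bandOp_pos (a b : TwoU .pos) : bandOp a b = a := by revert a b; decide

theorem bandOp_neg (a b : TwoU .neg) : bandOp a b = b := by revert a b; decide

/-- The term `bandOp p q`. -/
def BTerm.bandOp {S : Type u} (p q : BTerm S) : BTerm S :=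
  .tinf (.kinf p (.tsup p q)) (.ksup q (.tsup p q))

theorem BTerm.eval_bandOp {S : Type u} {A : Type v} [BilatOps A] (y : S → A) (p q : BTerm S) :
    (BTerm.bandOp p q).eval y = PreBilattice.bandOp (p.eval y) (q.eval y) := rfl

theorem BHom.map_bandOp {A : Type u} {B : Type v} [BilatOps A] [BilatOps B] (f : BHom A B)
    (a b : A) : f.toFun (bandOp a b) = bandOp (f.toFun a) (f.toFun b) := by
  unfold bandOp
  rw [f.map_tinf, f.map_kinf, f.map_ksup, f.map_tsup]

theorem BHom.map_eval {S : Type w} {A : Type u} {B : Type v} [BilatOps A] [BilatOps B]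
    (f : BHom A B) (y : S → A) (p : BTerm S) :
    f.toFun (p.eval y) = p.eval (fun i => f.toFun (y i)) := by
  induction p with
  | var i => rfl
  | tsup p q hp hq => exact (f.map_tsup _ _).trans (congrArg₂ _ hp hq)
  | tinf p q hp hq => exact (f.map_tinf _ _).trans (congrArg₂ _ hp hq)
  | ksup p q hp hq => exact (f.map_ksup _ _).trans (congrArg₂ _ hp hq)
  | kinf p q hp hq => exact (f.map_kinf _ _).trans (congrArg₂ _ hp hq)

theorem tinf_twoU {s : Sgn} (a b : TwoU s) :
    tinf a b = (show TwoU s from Bool.and a b) := by cases s <;> rfl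

theorem tsup_twoU {s : Sgn} (a b : TwoU s) :
    tsup a b = (show TwoU s from Bool.or a b) := by cases s <;> rfl

/-- The meet of a non-empty finite set of variables, as a term. -/
theorem exists_term_meet {S : Type u} {F : Finset S} (hF : F.Nonempty) :
    ∃ p : BTerm S, ∀ s (x : S → TwoU s), p.eval x = true ↔ ∀ i ∈ F, x i = true := by
  classical
  induction hF using Finset.Nonempty.cons_induction with
  | singleton i => exact ⟨.var i, fun s x => by simp [BTerm.eval]⟩
  | cons i F hi hF ih =>
    obtain ⟨p, hp⟩ := ih
    refine ⟨.tinf (.var i) p, fun s x => ?_⟩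
    rw [Finset.forall_mem_cons, ← hp, BTerm.eval, tinf_twoU]
    exact Bool.and_eq_true_iff

/-- The join of a non-empty finite set of variables, as a term. -/
theorem exists_term_join {S : Type u} {F : Finset S} (hF : F.Nonempty) :
    ∃ p : BTerm S, ∀ s (x : S → TwoU s), p.eval x = false ↔ ∀ i ∈ F, x i = false := by
  classical
  induction hF using Finset.Nonempty.cons_induction with
  | singleton i => exact ⟨.var i, fun s x => by simp [BTerm.eval]⟩
  | cons i F hi hF ih =>
    obtain ⟨p, hp⟩ := ih
    refine ⟨.tsup (.var i) p, fun s x => ?_⟩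
    rw [Finset.forall_mem_cons, ← hp, BTerm.eval, tsup_twoU]
    exact Bool.or_eq_false_iff

/-- A point outside a closed subset of a power is separated from it by a finite set of coordinates. -/
theorem exists_finset_of_notMem {S : Type u} {s : Sgn} {C : Set (S → TwoU s)} (hC : IsClosed C)
    {y : S → TwoU s} (hy : y ∉ C) : ∃ F : Finset S, ∀ x ∈ C, ∃ i ∈ F, x i ≠ y i := by
  obtain ⟨F, U, hU, hF⟩ := isOpen_pi_iff.1 hC.isOpen_compl y hy
  refine ⟨F, fun x hx => ?_⟩
  by_contra! hc
  exact hF (fun i hi => by rw [hc i hi]; exact (hU i hi).2) hx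

theorem ClosedSub.termClosed {S : Type u} (C : ClosedSub (power S)) : C.TermClosed := by
  classical
  intro s y hy
  obtain ⟨F, hF⟩ := exists_finset_of_notMem (C.closed s) hy
  -- The constants lie in `C`, so `y` differs from each of them on `F`. Hence both filters are
  -- non-empty, as is necessary in the absence of constant terms.
  have h1 : (F.filter fun i => y i = true).Nonempty := by
    obtain ⟨i, hi, hne⟩ := hF _ (C.zero_mem s)
    exact ⟨i, Finset.mem_filter.2 ⟨hi, Bool.eq_true_of_not_eq_false hne.symm⟩⟩
  have h0 : (F.filter fun i => y i = false).Nonempty := by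
    obtain ⟨i, hi, hne⟩ := hF _ (C.one_mem s)
    exact ⟨i, Finset.mem_filter.2 ⟨hi, Bool.eq_false_iff.2 hne.symm⟩⟩
  obtain ⟨p, hp⟩ := exists_term_meet h1
  obtain ⟨q, hq⟩ := exists_term_join h0
  have hpy : p.eval y = true := (hp s y).2 fun i hi => (Finset.mem_filter.1 hi).2
  have hqy : q.eval y = false := (hq s y).2 fun i hi => (Finset.mem_filter.1 hi).2
  have hy' : (BTerm.tinf p q).eval y ≠ p.eval y := by
    rw [BTerm.eval, tinf_twoU, hpy, hqy]
    exact Bool.false_ne_true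
  -- If `p` were 1 and `q` were 0 at `x`, then `x` would agree with `y` on all of `F`. Thus `p ≤ q`
  -- on `C`, while this fails at `y`.
  have hC : ∀ x ∈ C.sets s, (BTerm.tinf p q).eval (A := TwoU s) x = p.eval x := by
    intro x hx
    change S → TwoU s at x
    rw [BTerm.eval, tinf_twoU]
    cases hpx : p.eval (A := TwoU s) x with
    | false => rfl
    | true =>
      cases hqx : q.eval (A := TwoU s) x with
      | true => rfl
      | false =>
        obtain ⟨i, hi, hne⟩ := hF x hx
        refine absurd ?_ hne
        cases hyi : y i with
        | true => exact (hp s x).1 hpx i (Finset.mem_filter.2 ⟨hi, hyi⟩)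
        | false => exact (hq s x).1 hqx i (Finset.mem_filter.2 ⟨hi, hyi⟩)
  cases s with
  | pos =>
    -- In the negative sort only the second slot counts, and it holds `p` on both sides.
    refine ⟨.bandOp (.tinf p q) p, .bandOp p p, fun r x hx => ?_, ?_⟩
    · change S → TwoU r at x
      cases r
      · rw [BTerm.eval_bandOp, BTerm.eval_bandOp, bandOp_pos, bandOp_pos, hC x hx]
      · rw [BTerm.eval_bandOp, BTerm.eval_bandOp, bandOp_neg, bandOp_neg]
    · rwa [BTerm.eval_bandOp, BTerm.eval_bandOp, bandOp_pos, bandOp_pos]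
  | neg =>
    refine ⟨.bandOp p (.tinf p q), .bandOp p p, fun r x hx => ?_, ?_⟩
    · change S → TwoU r at x
      cases r
      · rw [BTerm.eval_bandOp, BTerm.eval_bandOp, bandOp_pos, bandOp_pos]
      · rw [BTerm.eval_bandOp, BTerm.eval_bandOp, bandOp_neg, bandOp_neg, hC x hx]
    · rwa [BTerm.eval_bandOp, BTerm.eval_bandOp, bandOp_neg, bandOp_neg]

theorem yieldsStrongDuality : YieldsStrongDuality.{u} :=
  ⟨yieldsDuality, fun _ _ C => C.termClosed, alterEgoInjective⟩

/-! ### Full duality -/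

/-- Bijective embeddings are isomorphisms. -/
theorem TSHom.IsEmb.isIso {X Y : TSStruct.{u}} (f : X ⟶ Y) (hf : TSHom.IsEmb f)
    (hs : ∀ s, Function.Surjective (TSHom.toFun f s)) : IsIso f := by
  let e (s) := (hf.emb s).toHomeomorphOfSurjective (hs s)
  have he (s) (y) : TSHom.toFun f s ((e s).symm y) = y := (e s).apply_symm_apply y
  have he' (s) (x) : (e s).symm (TSHom.toFun f s x) = x := (e s).symm_apply_apply x
  let g : TSHom Y X :=
    { toFun := fun s => (e s).symm
      cont := fun s => (e s).symm.continuous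
      map_rel := fun s x y h => hf.reflect s _ _ (by rwa [he, he])
      map_zero := fun s => by rw [← TSHom.map_zero f, he']
      map_one := fun s => by rw [← TSHom.map_one f, he'] }
  exact ⟨g, TSHom.ext (funext fun s => funext (he' s)), TSHom.ext (funext fun s => funext (he s))⟩

theorem yieldsFullDuality : YieldsFullDuality.{u} := by
  refine ⟨yieldsDuality, fun X => ?_⟩
  rw [← ObjectProperty.isIso_hom_iff]
  have : Nonempty (TSHom X.obj alterEgo) := nonempty_hom X.property
  have hc := X.property.compactSpace
  have hcont (s) := TSHom.cont (X := X.obj) (Y := homStruct (TSHom X.obj alterEgo))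
    (evalSpace X).hom s
  have hinj (s) : Function.Injective (TSHom.toFun (X := X.obj)
      (Y := homStruct (TSHom X.obj alterEgo)) (evalSpace X).hom s) := fun x y hxy =>
    X.property.eq_of_forall_hom fun f => congrFun (congrArg BHom.toFun hxy) f
  have ht (s) : Topology.IsClosedEmbedding (fun x : X.obj.carrier s =>
      fun f : TSHom X.obj alterEgo => (show TwoU s from f.toFun s x)) :=
    Continuous.isClosedEmbedding (continuous_pi fun f => f.cont s) fun x y hxy =>
      X.property.eq_of_forall_hom fun f => congrFun hxy f
  refine TSHom.IsEmb.isIso _ ⟨fun s => ?_, fun s x y h => X.property.rel_of_forall_hom h⟩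
    fun s h => ?_
  · exact .of_comp (hcont s) continuous_induced_dom (ht s).isEmbedding
  · let C : ClosedSub (power (TSHom X.obj alterEgo)) :=
      { sets := fun s => Set.range fun x f => f.toFun s x
        closed := fun s => (ht s).isClosed_range
        zero_mem := fun s => ⟨X.obj.zero s, funext fun f => f.map_zero s⟩
        one_mem := fun s => ⟨X.obj.one s, funext fun f => f.map_one s⟩ }
    have hmem : BHom.toFun h ∈ C.sets s := by
      by_contra hn
      obtain ⟨p, q, hpq, hne⟩ := C.termClosed s _ hn
      -- The variables are the elements of E(X) themselves. Agreement of the terms on the image of X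
      -- is equality of their values in E(X), which the homomorphism `h` must respect.
      have heq : p.eval (fun f : TSHom X.obj alterEgo => f) = q.eval fun f => f := by
        refine TSHom.ext (funext fun r => funext fun x => ?_)
        let ex : BHom (TSHom X.obj alterEgo) (TwoU r) :=
          ⟨fun f => f.toFun r x, fun _ _ => rfl, fun _ _ => rfl, fun _ _ => rfl, fun _ _ => rfl⟩
        have := hpq r _ ⟨x, rfl⟩
        exact (ex.map_eval _ p).trans (this.trans (ex.map_eval _ q).symm)
      exact hne ((BHom.map_eval h _ p).symm.trans
        ((congrArg (BHom.toFun h) heq).trans (BHom.map_eval h _ q)))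
    obtain ⟨x, hx⟩ := hmem
    exact ⟨x, BHom.ext hx⟩

/-! ### The equivalence with pairs of distributive lattices -/

/-- The product of two lattices, with the order of the second factor reversed for knowledge. -/
instance prodOps (L : Type u) (K : Type v) [Lattice L] [Lattice K] : BilatOps (L × K) where
  tsup a b := (a.1 ⊔ b.1, a.2 ⊔ b.2)
  tinf a b := (a.1 ⊓ b.1, a.2 ⊓ b.2)
  ksup a b := (a.1 ⊔ b.1, a.2 ⊓ b.2)
  kinf a b := (a.1 ⊓ b.1, a.2 ⊔ b.2)

theorem isUnboundedDPB_prod (L : Type u) (K : Type v) [DistribLattice L] [DistribLattice K] :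
    IsUnboundedDPB (L × K) := by
  constructor
  · exact ⟨fun _ _ => Prod.ext (sup_comm _ _) (sup_comm _ _),
      fun _ _ => Prod.ext (inf_comm _ _) (inf_comm _ _),
      fun _ _ _ => Prod.ext (sup_assoc _ _ _) (sup_assoc _ _ _),
      fun _ _ _ => Prod.ext (inf_assoc _ _ _) (inf_assoc _ _ _),
      fun _ _ => Prod.ext sup_inf_self sup_inf_self, fun _ _ => Prod.ext inf_sup_self inf_sup_self⟩
  · exact ⟨fun _ _ => Prod.ext (sup_comm _ _) (inf_comm _ _),
      fun _ _ => Prod.ext (inf_comm _ _) (sup_comm _ _),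
      fun _ _ _ => Prod.ext (sup_assoc _ _ _) (inf_assoc _ _ _),
      fun _ _ _ => Prod.ext (inf_assoc _ _ _) (sup_assoc _ _ _),
      fun _ _ => Prod.ext sup_inf_self inf_sup_self, fun _ _ => Prod.ext inf_sup_self sup_inf_self⟩
  all_goals
    intro a b c
    apply Prod.ext <;> simp only [tsup, tinf, ksup, kinf] <;>
    first
    | exact sup_inf_left _ _ _
    | exact inf_sup_left _ _ _
    | exact sup_sup_distrib_left _ _ _
    | exact inf_inf_distrib_left _ _ _

/-- The first factor behaves like `2_u^+` and the second like `2_u^-`; absorption does the rest. -/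
theorem bandOp_prod {L : Type u} {K : Type v} [Lattice L] [Lattice K] (a b : L × K) :
    bandOp a b = (a.1, b.2) := by
  apply Prod.ext
  · change (a.1 ⊓ (a.1 ⊔ b.1)) ⊓ (b.1 ⊔ (a.1 ⊔ b.1)) = a.1
    rw [inf_sup_self, sup_left_comm, inf_sup_self]
  · change (a.2 ⊔ (a.2 ⊔ b.2)) ⊓ (b.2 ⊓ (a.2 ⊔ b.2)) = b.2
    rw [inf_eq_right.2 (inf_le_right.trans le_sup_right), inf_eq_left.2 le_sup_right]

/-- The functor sending a pair of lattices to its product. -/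
def prodFunctor : Du.{u} × Du.{u} ⥤ DPBu.{u} where
  obj P := ⟨{ carrier := P.1.obj × P.2.obj
              nonempty :=
                haveI := P.1.property
                haveI := P.2.property
                inferInstance },
    isUnboundedDPB_prod P.1.obj P.2.obj⟩
  map {P Q} f := ObjectProperty.homMk
    (show BHom (P.1.obj × P.2.obj) (Q.1.obj × Q.2.obj) from
      { toFun := fun p => (f.1.hom p.1, f.2.hom p.2)
        map_tsup := fun a b => Prod.ext (map_sup f.1.hom.hom _ _) (map_sup f.2.hom.hom _ _)
        map_tinf := fun a b => Prod.ext (map_inf f.1.hom.hom _ _) (map_inf f.2.hom.hom _ _)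
        map_ksup := fun a b => Prod.ext (map_sup f.1.hom.hom _ _) (map_inf f.2.hom.hom _ _)
        map_kinf := fun a b => Prod.ext (map_inf f.1.hom.hom _ _) (map_sup f.2.hom.hom _ _) })

instance : prodFunctor.{u}.Faithful where
  map_injective {P Q} f g h := by
    -- Non-emptiness is essential: each component is recovered by freezing the other coordinate.
    obtain ⟨k⟩ := P.2.property
    obtain ⟨l⟩ := P.1.property
    have h' (p : P.1.obj × P.2.obj) :
        ((f.1.hom p.1, f.2.hom p.2) : Q.1.obj × Q.2.obj) = (g.1.hom p.1, g.2.hom p.2) :=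
      congrFun (congrArg (fun m => BHom.toFun (InducedCategory.Hom.hom m)) h) p
    refine Prod.ext ?_ ?_
    · exact ObjectProperty.hom_ext _ (DistLat.ext fun x => congrArg Prod.fst (h' (x, k)))
    · exact ObjectProperty.hom_ext _ (DistLat.ext fun x => congrArg Prod.snd (h' (l, x)))

/-- Homomorphisms between products of lattices decompose. -/
theorem BHom.exists_eq_prodMap {L K L' K' : Type u} [Lattice L] [Lattice K] [Lattice L']
    [Lattice K'] [Nonempty L] [Nonempty K] (h : BHom (L × K) (L' × K')) :
    ∃ (f : LatticeHom L L') (g : LatticeHom K K'), ∀ p, h.toFun p = (f p.1, g p.2) := by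
  obtain ⟨l₀⟩ := ‹Nonempty L›
  obtain ⟨k₀⟩ := ‹Nonempty K›
  -- The pair `(l, k')` is `bandOp (l, k) (l', k')`, so preservation of this term makes each output
  -- coordinate depend on its own input coordinate alone.
  have key (l l' k k') : h.toFun (l, k') = ((h.toFun (l, k)).1, (h.toFun (l', k')).2) := by
    rw [← bandOp_prod, ← h.map_bandOp, bandOp_prod]
  refine ⟨⟨⟨fun l => (h.toFun (l, k₀)).1, fun a b => ?_⟩, fun a b => ?_⟩,
    ⟨⟨fun k => (h.toFun (l₀, k)).2, fun a b => ?_⟩, fun a b => ?_⟩, fun p => key _ _ _ _⟩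
  · simpa [tsup] using congrArg Prod.fst (h.map_tsup (a, k₀) (b, k₀))
  · simpa [tinf] using congrArg Prod.fst (h.map_tinf (a, k₀) (b, k₀))
  · simpa [tsup] using congrArg Prod.snd (h.map_tsup (l₀, a) (l₀, b))
  · simpa [tinf] using congrArg Prod.snd (h.map_tinf (l₀, a) (l₀, b))

instance : prodFunctor.{u}.Full where
  map_surjective {P Q} h := by
    have := P.1.property
    have := P.2.property
    obtain ⟨f, g, hfg⟩ := BHom.exists_eq_prodMap (L := P.1.obj) (K := P.2.obj) (L' := Q.1.obj)
      (K' := Q.2.obj) h.hom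
    exact ⟨(ObjectProperty.homMk (DistLat.ofHom f), ObjectProperty.homMk (DistLat.ofHom g)),
      ObjectProperty.hom_ext _ (BHom.ext (funext fun p => (hfg p).symm))⟩

/-! ### Band identities and the two factors of an algebra -/

section Decomposition

variable {A : Type u} [BilatOps A]

theorem IsUnboundedDPB.bandOp_self (h : IsUnboundedDPB A) (a : A) : bandOp a a = a :=
  h.eq_of_forall_hom fun s f => by
    cases s
    · rw [f.map_bandOp, bandOp_pos]
    · rw [f.map_bandOp, bandOp_neg]

theorem IsUnboundedDPB.bandOp_bandOp_left (h : IsUnboundedDPB A) (a b c : A) :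
    bandOp (bandOp a b) c = bandOp a c :=
  h.eq_of_forall_hom fun s f => by
    cases s
    · simp only [f.map_bandOp, bandOp_pos]
    · simp only [f.map_bandOp, bandOp_neg]

theorem IsUnboundedDPB.bandOp_bandOp_right (h : IsUnboundedDPB A) (a b c : A) :
    bandOp a (bandOp b c) = bandOp a c :=
  h.eq_of_forall_hom fun s f => by
    cases s
    · simp only [f.map_bandOp, bandOp_pos]
    · simp only [f.map_bandOp, bandOp_neg]

theorem IsUnboundedDPB.bandOp_tsup (h : IsUnboundedDPB A) (a b c d : A) :
    bandOp (tsup a b) (tsup c d) = tsup (bandOp a c) (bandOp b d) :=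
  h.eq_of_forall_hom fun s f => by
    cases s
    · simp only [f.map_bandOp, f.map_tsup, bandOp_pos]
    · simp only [f.map_bandOp, f.map_tsup, bandOp_neg]

theorem IsUnboundedDPB.bandOp_tinf (h : IsUnboundedDPB A) (a b c d : A) :
    bandOp (tinf a b) (tinf c d) = tinf (bandOp a c) (bandOp b d) :=
  h.eq_of_forall_hom fun s f => by
    cases s
    · simp only [f.map_bandOp, f.map_tinf, bandOp_pos]
    · simp only [f.map_bandOp, f.map_tinf, bandOp_neg]

theorem IsUnboundedDPB.bandOp_ksup (h : IsUnboundedDPB A) (a b c d : A) :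
    bandOp (tsup a b) (tinf c d) = ksup (bandOp a c) (bandOp b d) :=
  h.eq_of_forall_hom fun s f => by
    cases s
    -- On `2_u^+` the truth and knowledge joins are the same operation; on `2_u^-` the knowledge
    -- join is the truth meet.
    · simp only [f.map_bandOp, f.map_tsup, f.map_tinf, f.map_ksup, bandOp_pos]; rfl
    · simp only [f.map_bandOp, f.map_tsup, f.map_tinf, f.map_ksup, bandOp_neg]; rfl

theorem IsUnboundedDPB.bandOp_kinf (h : IsUnboundedDPB A) (a b c d : A) :
    bandOp (tinf a b) (tsup c d) = kinf (bandOp a c) (bandOp b d) :=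
  h.eq_of_forall_hom fun s f => by
    cases s
    · simp only [f.map_bandOp, f.map_tsup, f.map_tinf, f.map_kinf, bandOp_pos]; rfl
    · simp only [f.map_bandOp, f.map_tsup, f.map_tinf, f.map_kinf, bandOp_neg]; rfl

/-- The first factor in the decomposition of `A` by `bandOp` at a base point. -/
abbrev IsUnboundedDPB.posFactor (h : IsUnboundedDPB A) (c : A) :
    DistribLattice {a : A // bandOp a c = a} :=
  letI := h.tLattice
  Subtype.distribLattice
    (fun a b ha hb => by
      have := h.bandOp_tsup a b c c
      rwa [h.t_lattice.join_self, ha, hb] at this)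
    (fun a b ha hb => by
      have := h.bandOp_tinf a b c c
      rwa [h.t_lattice.symm.join_self, ha, hb] at this)

/-- The second factor in the decomposition of `A` by `bandOp` at a base point. -/
abbrev IsUnboundedDPB.negFactor (h : IsUnboundedDPB A) (c : A) :
    DistribLattice {a : A // bandOp c a = a} :=
  letI := h.tLattice
  Subtype.distribLattice
    (fun a b ha hb => by
      have := h.bandOp_tsup c c a b
      rwa [h.t_lattice.join_self, ha, hb] at this)
    (fun a b ha hb => by
      have := h.bandOp_tinf c c a b
      rwa [h.t_lattice.symm.join_self, ha, hb] at this)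

/-- The decomposition of an unbounded distributive pre-bilattice as a product of lattices. -/
theorem IsUnboundedDPB.exists_bijective_prod [Nonempty A] (h : IsUnboundedDPB A) :
    ∃ (L K : Du.{u}) (f : BHom (L.obj × K.obj) A), Function.Bijective f.toFun := by
  obtain ⟨c⟩ := ‹Nonempty A›
  let _ := h.posFactor c
  let _ := h.negFactor c
  refine ⟨⟨DistLat.of {a : A // bandOp a c = a}, ⟨c, h.bandOp_self c⟩⟩,
    ⟨DistLat.of {a : A // bandOp c a = a}, ⟨c, h.bandOp_self c⟩⟩,
    ⟨fun p => bandOp p.1.1 p.2.1, fun p q => h.bandOp_tsup _ _ _ _, fun p q => h.bandOp_tinf _ _ _ _,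
      fun p q => h.bandOp_ksup _ _ _ _, fun p q => h.bandOp_kinf _ _ _ _⟩, ?_, fun a => ?_⟩
  · rintro ⟨⟨a, ha⟩, b, hb⟩ ⟨⟨a', ha'⟩, b', hb'⟩ he
    change bandOp a b = bandOp a' b' at he
    -- Replacing the second slot of `bandOp a b` by `c` recovers `a`, since `a` is fixed by `bandOp
    -- · c`; dually for `b`.
    have h1 : a = a' := by rw [← ha, ← ha', ← h.bandOp_bandOp_left a b, he, h.bandOp_bandOp_left]
    have h2 : b = b' := by rw [← hb, ← hb', ← h.bandOp_bandOp_right c a b, he, h.bandOp_bandOp_right]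
    subst h1 h2
    rfl
  · refine ⟨⟨⟨bandOp a c, h.bandOp_bandOp_left _ _ _⟩, bandOp c a, h.bandOp_bandOp_right _ _ _⟩, ?_⟩
    change bandOp (bandOp a c) (bandOp c a) = a
    rw [h.bandOp_bandOp_left, h.bandOp_bandOp_right, h.bandOp_self]

end Decomposition

instance : prodFunctor.{u}.EssSurj where
  mem_essImage A := by
    obtain ⟨L, K, f, hf⟩ := IsUnboundedDPB.exists_bijective_prod A.property
    let g : prodFunctor.obj (L, K) ⟶ A := ObjectProperty.homMk f
    have : IsIso g := by
      rw [← ObjectProperty.isIso_hom_iff]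
      exact BHom.bijective_isIso _ hf
    exact ⟨(L, K), ⟨asIso g⟩⟩

instance : prodFunctor.{u}.IsEquivalence where

end PreBilattice

theorem theorem10p3 :
    PreBilattice.dpbClass.{u} = PreBilattice.ispClass.{u} PreBilattice.TwoU ∧
    PreBilattice.YieldsStrongDuality.{u} ∧
    PreBilattice.YieldsFullDuality.{u} ∧
    Nonempty (PreBilattice.DPBu.{u} ≌ PreBilattice.Du.{u} × PreBilattice.Du.{u}) :=
  ⟨PreBilattice.dpbClass_eq_ispClass, PreBilattice.yieldsStrongDuality,
    PreBilattice.yieldsFullDuality, ⟨PreBilattice.prodFunctor.asEquivalence.symm⟩⟩
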